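/- For $r\in(0,1)$ let $r'=\sqrt{1-r^2}$ and $$\mathcal K(r)=\int_0^1\frac{dx}{\sqrt{(1-x^2)(1-r^2x^2)}},\qquad \mu(r)=\frac{\pi}{2}\,\frac{\mathcal K(r')}{\mathcal K(r)} ,$$ so that $\mu:(0,1)\to(0,\infty)$ is a decreasing homeomorphism. For $K>0$ let $\varphi_K:(0,1)\to(0,1)$, $\varphi_K(r)=\mu^{-1}(\mu(r)/K)$, and let $c(K)=2\,\mathrm{arth}\bigl(\varphi_K(\mathrm{th}\tfrac12)\bigr)$, where $\mathrm{th}$ is the hyperbolic tangent and $\mathrm{arth}$ is its inverse function. Then for every real $K>1$ the function $$h(t)=\frac{2\,\mathrm{arth}\bigl(\varphi_K(\mathrm{th}\tfrac t2)\bigr)}{\max\{t,t^{1/K}\}},\qquad t>0,$$ is strictly increasing on $(0,1)$ and strictly decreasing on $(1,\infty)$. Moreover $h(1)=c(K)$ and $h(t)\le c(K)$ for all $t>0$, that is, the maximum of $h$ on $(0,\infty)$ is $c(K)$ and it is attained at $t=1$. -/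

import Mathlib

noncomputable section

/-- Legendre's complete elliptic integral of the first kind, as a function of the modulus `r`:
`𝒦(r) = ∫₀¹ dx / √((1 - x²)(1 - r²x²))`. -/
def ellipticK (r : ℝ) : ℝ :=
  ∫ x in (0 : ℝ)..1, 1 / Real.sqrt ((1 - x ^ 2) * (1 - r ^ 2 * x ^ 2))

/-- The function `μ(r) = (π / 2) 𝒦(r') / 𝒦(r)`, with `r' = √(1 - r²)`, for `0 < r < 1`. -/
def modulusMu (r : ℝ) : ℝ :=
  Real.pi / 2 * (ellipticK (Real.sqrt (1 - r ^ 2)) / ellipticK r)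

/-- The inverse of `μ : (0, 1) → (0, ∞)`: for `y > 0`, `modulusMuInv y` is the point `s` of
`(0, 1)` with `μ(s) = y`. -/
def modulusMuInv (y : ℝ) : ℝ :=
  Function.invFunOn modulusMu (Set.Ioo 0 1) y

/-- The Hersch-Pfluger distortion function `φ_K(r) = μ⁻¹(μ(r) / K)`, for `0 < r < 1`, `K > 0`. -/
def phiK (K r : ℝ) : ℝ :=
  modulusMuInv (modulusMu r / K)

/-- The constant `c(K) = 2 arth(φ_K(th(1/2)))`. -/
def cConst (K : ℝ) : ℝ :=
  2 * Real.artanh (phiK K (Real.tanh (1 / 2)))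

/-- The function `t ↦ 2 arth(φ_K(th(t/2))) / max{t, t^{1/K}}`, for `t > 0`. -/
def distortionRatio (K t : ℝ) : ℝ :=
  2 * Real.artanh (phiK K (Real.tanh (t / 2))) / max t (t ^ (1 / K))

end

/-!
Write `𝒦, ℰ` for the complete elliptic integrals at `r`, `𝒦', ℰ'` for their values at
`r' = √(1 - r²)`, and `s = φ_K(r)`, so that `s > r` when `K > 1`. The derivatives of `𝒦` and `ℰ`
give Legendre's relation, that `ℰ'𝒦 + ℰ𝒦' - 𝒦𝒦'` is a positive constant; hence `dμ/dr`
is a constant multiple of `1 / (r r'² 𝒦²)`, and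

  `d(artanh s) / d(artanh r) = s 𝒦(s)² / (K r 𝒦(r)²)`.

With `t = 2 artanh r`, the theorem says that `(artanh s) / (artanh r) ^ (1 / K)` increases and
`(artanh s) / (artanh r)` decreases. Computing the logarithmic derivatives, and replacing `1 / K` by
`μ(s) / μ(r)` in the second case, these two facts reduce to the monotonicity of functions of one
variable:

* `r 𝒦² / artanh r` is strictly increasing (`strictMonoOn_mul_ellipticK_sq_div_artanh`);
* `r 𝒦 𝒦' / artanh r` is strictly decreasing
  (`strictAntiOn_mul_ellipticK_mul_ellipticK_compl_div_artanh`).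

Both follow from a monotone l'Hôpital rule (`strictMonoOn_div_artanh`). The quotients of derivatives
are `𝒦 (2ℰ - r'² 𝒦)`, a product of two increasing functions, and `(2ℰ - r'² 𝒦) 𝒦'` minus the
Legendre constant. The latter decreases by elementary inequalities between `𝒦` and `ℰ`, of which
the least obvious is `2 r'² 𝒦 < (1 + r'²) ℰ` (`two_mul_one_sub_sq_mul_ellipticK_lt`).

The first of these monotonicity results also shows that `𝒦` is unbounded near `1`, whence `μ` is a
bijection of `(0, 1)` onto `(0, ∞)` (`bijOn_modulusMu`) and `φ_K` takes the values it should.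
-/

open Real Set Filter Topology MeasureTheory

/-! ### The complete elliptic integrals in trigonometric form -/

/-- Legendre's complete elliptic integral of the second kind, `ℰ(r) = ∫ √(1 - r² sin² θ) dθ` over
`[0, π / 2]`, as a function of the modulus `r`. -/
noncomputable def ellipticE (r : ℝ) : ℝ :=
  ∫ θ in (0 : ℝ)..π / 2, √(1 - (r * sin θ) ^ 2)

theorem sq_mul_sin_lt_one {r : ℝ} (hr : |r| < 1) (θ : ℝ) : (r * sin θ) ^ 2 < 1 := by
  rw [sq_lt_one_iff_abs_lt_one, abs_mul]
  exact lt_of_le_of_lt (mul_le_of_le_one_right (abs_nonneg r) (abs_sin_le_one θ)) hr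

theorem continuous_comp_sq_mul_sin {f : ℝ → ℝ} (hf : ContinuousOn f (Iio 1)) {r : ℝ}
    (hr : |r| < 1) : Continuous fun θ => f ((r * sin θ) ^ 2) :=
  hf.comp_continuous (by fun_prop) fun θ => sq_mul_sin_lt_one hr θ

/-- Differentiation under the integral sign with respect to the modulus. -/
theorem hasDerivAt_integral_sq_mul_sin {f f' : ℝ → ℝ} (hf : ∀ x < 1, HasDerivAt f (f' x) x)
    (hf' : ContinuousOn f' (Iio 1)) {r : ℝ} (hr : |r| < 1) :
    HasDerivAt (fun r => ∫ θ in (0 : ℝ)..π / 2, f ((r * sin θ) ^ 2))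
      (∫ θ in (0 : ℝ)..π / 2, f' ((r * sin θ) ^ 2) * (2 * r * sin θ ^ 2)) r := by
  obtain ⟨ρ, hρ, hρ1⟩ := exists_between hr
  have hρ0 : 0 < ρ := (abs_nonneg r).trans_lt hρ
  have hfc : ContinuousOn f (Iio 1) := fun x hx => (hf x hx).continuousAt.continuousWithinAt
  have hlt : ∀ x ∈ Ioo (-ρ) ρ, |x| < 1 := fun x hx => (abs_lt.2 hx).trans hρ1
  obtain ⟨C, hC⟩ := (isCompact_Icc (a := (0 : ℝ)) (b := ρ ^ 2)).exists_bound_of_continuousOn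
    (hf'.mono fun x hx => lt_of_le_of_lt hx.2 (by nlinarith))
  have hC0 : 0 ≤ C := (norm_nonneg _).trans (hC 0 ⟨le_rfl, by positivity⟩)
  refine (intervalIntegral.hasDerivAt_integral_of_dominated_loc_of_deriv_le
    (F := fun r θ => f ((r * sin θ) ^ 2))
    (F' := fun r θ => f' ((r * sin θ) ^ 2) * (2 * r * sin θ ^ 2))
    (s := Ioo (-ρ) ρ) (bound := fun _ => C * 2) (Ioo_mem_nhds (abs_lt.1 hρ).1 (abs_lt.1 hρ).2)
    ?_ ?_ ?_ ?_ ?_ ?_).2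
  · filter_upwards [Ioo_mem_nhds (abs_lt.1 hρ).1 (abs_lt.1 hρ).2] with x hx
    exact (continuous_comp_sq_mul_sin hfc (hlt x hx)).aestronglyMeasurable
  · exact (continuous_comp_sq_mul_sin hfc hr).intervalIntegrable _ _
  · exact ((continuous_comp_sq_mul_sin hf' hr).mul (by fun_prop)).aestronglyMeasurable
  · refine Eventually.of_forall fun θ _ x hx => ?_
    have hx' : |x| < ρ := abs_lt.2 hx
    rw [norm_mul]
    refine mul_le_mul (hC _ ⟨by positivity, ?_⟩) ?_ (norm_nonneg _) hC0
    · rw [← sq_abs, abs_mul]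
      exact pow_le_pow_left₀ (by positivity)
        ((mul_le_of_le_one_right (abs_nonneg x) (abs_sin_le_one θ)).trans hx'.le) 2
    · rw [norm_eq_abs, abs_mul, abs_mul, abs_two, abs_of_nonneg (sq_nonneg (sin θ))]
      nlinarith [sin_sq_le_one θ, sq_nonneg (sin θ), abs_nonneg x]
  · exact intervalIntegrable_const
  · refine Eventually.of_forall fun θ _ x hx => ?_
    have h := (hf _ (sq_mul_sin_lt_one (hlt x hx) θ)).comp x
      (((hasDerivAt_id x).mul_const (sin θ)).pow 2)
    refine h.congr_deriv ?_
    simp only [id]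
    ring

/-- The substitution `x = sin θ` brings `ellipticK` to trigonometric form. -/
theorem ellipticK_eq_integral_sin (r : ℝ) :
    ellipticK r = ∫ θ in (0 : ℝ)..π / 2, (√(1 - (r * sin θ) ^ 2))⁻¹ := by
  have himg : sin '' Ioo 0 (π / 2) = Ioo 0 1 := by
    ext y
    constructor
    · rintro ⟨θ, hθ, rfl⟩
      exact ⟨sin_pos_of_pos_of_lt_pi hθ.1 (by linarith [hθ.2, pi_pos]),
        sin_pi_div_two ▸ sin_lt_sin_of_lt_of_le_pi_div_two (by linarith [hθ.1, pi_pos]) le_rfl hθ.2⟩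
    · intro hy
      exact ⟨arcsin y, ⟨arcsin_pos.2 hy.1, arcsin_lt_pi_div_two.2 hy.2⟩,
        sin_arcsin (by linarith [hy.1]) hy.2.le⟩
  have hinj : InjOn sin (Ioo 0 (π / 2)) :=
    injOn_sin.mono fun x hx => mem_Icc.2 (And.intro (by linarith [hx.1, pi_pos]) hx.2.le)
  rw [ellipticK, intervalIntegral.integral_of_le zero_le_one,
    intervalIntegral.integral_of_le (by positivity), integral_Ioc_eq_integral_Ioo,
    integral_Ioc_eq_integral_Ioo, ← himg,
    integral_image_eq_integral_abs_deriv_smul measurableSet_Ioo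
      (fun x _ => (hasDerivAt_sin x).hasDerivWithinAt) hinj]
  refine setIntegral_congr_fun measurableSet_Ioo fun θ hθ => ?_
  have hc : 0 < cos θ := cos_pos_of_mem_Ioo ⟨by linarith [hθ.1, pi_pos], hθ.2⟩
  have h1 : 1 - sin θ ^ 2 = cos θ ^ 2 := by linarith [sin_sq_add_cos_sq θ]
  simp only [smul_eq_mul, h1, ← mul_pow]
  rw [sqrt_mul (sq_nonneg _), sqrt_sq hc.le, abs_of_pos hc, one_div, mul_inv]
  field_simp

/-! ### Derivatives of the elliptic integrals -/

theorem hasDerivAt_sqrt_one_sub {x : ℝ} (hx : x < 1) :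
    HasDerivAt (fun x => √(1 - x)) (-1 / (2 * √(1 - x))) x :=
  ((hasDerivAt_id x).const_sub 1).sqrt (by simp only [id]; linarith)

theorem hasDerivAt_inv_sqrt_one_sub {x : ℝ} (hx : x < 1) :
    HasDerivAt (fun x => (√(1 - x))⁻¹) (1 / (2 * √(1 - x) ^ 3)) x := by
  have h : 0 < √(1 - x) := sqrt_pos.2 (by linarith)
  refine ((hasDerivAt_sqrt_one_sub hx).inv h.ne').congr_deriv ?_
  field_simp

theorem sqrt_one_sub_ne_zero {x : ℝ} (hx : x ∈ Iio (1 : ℝ)) : √(1 - x) ≠ 0 :=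
  (sqrt_pos.2 (by linarith [mem_Iio.1 hx])).ne'

theorem sqrt_one_sub_sq_sin_pos {r : ℝ} (hr : |r| < 1) (θ : ℝ) : 0 < √(1 - (r * sin θ) ^ 2) :=
  sqrt_pos.2 (by linarith [sq_mul_sin_lt_one hr θ])

theorem continuous_sqrt_one_sub_sq_sin (r : ℝ) : Continuous fun θ => √(1 - (r * sin θ) ^ 2) := by
  fun_prop

/-- The powers `Δ⁻ⁿ` of the Legendre form `Δ = √(1 - r² sin² θ)` are continuous in `θ`. -/
theorem continuous_inv_sqrt_pow {r : ℝ} (hr : |r| < 1) (n : ℕ) :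
    Continuous fun θ => (√(1 - (r * sin θ) ^ 2))⁻¹ ^ n :=
  ((continuous_sqrt_one_sub_sq_sin r).inv₀ fun θ => (sqrt_one_sub_sq_sin_pos hr θ).ne').pow n

theorem hasDerivAt_ellipticE {r : ℝ} (h0 : 0 < r) (h1 : r < 1) :
    HasDerivAt ellipticE ((ellipticE r - ellipticK r) / r) r := by
  have hr : |r| < 1 := by rwa [abs_of_pos h0]
  refine (hasDerivAt_integral_sq_mul_sin (f := fun x => √(1 - x))
    (fun x hx => hasDerivAt_sqrt_one_sub hx) (continuousOn_const.div (by fun_prop)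
      fun x hx => mul_ne_zero two_ne_zero (sqrt_one_sub_ne_zero hx)) hr).congr_deriv ?_
  have hi := (continuous_inv_sqrt_pow hr 1).intervalIntegrable (μ := volume) 0 (π / 2)
  simp only [pow_one] at hi
  rw [ellipticE, ellipticK_eq_integral_sin, ← intervalIntegral.integral_sub
    ((continuous_sqrt_one_sub_sq_sin r).intervalIntegrable _ _) hi, eq_div_iff h0.ne',
    ← intervalIntegral.integral_mul_const]
  refine intervalIntegral.integral_congr fun θ _ => ?_
  have hd := sqrt_one_sub_sq_sin_pos hr θ
  have hs : √(1 - (r * sin θ) ^ 2) ^ 2 = 1 - (r * sin θ) ^ 2 :=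
    sq_sqrt (by linarith [sq_mul_sin_lt_one hr θ])
  generalize √(1 - (r * sin θ) ^ 2) = d at *
  field_simp
  rw [hs]
  ring

/-- Integrating the derivative of `r² sin θ cos θ / Δ` over `[0, π/2]` gives
`(1 - r²) ∫ Δ⁻³ = ∫ Δ`. -/
theorem one_sub_sq_mul_integral_inv_sqrt_pow_three {r : ℝ} (hr : |r| < 1) :
    (1 - r ^ 2) * ∫ θ in (0 : ℝ)..π / 2, (√(1 - (r * sin θ) ^ 2))⁻¹ ^ 3 = ellipticE r := by
  have hE := (continuous_sqrt_one_sub_sq_sin r).intervalIntegrable (μ := volume) 0 (π / 2)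
  have h3 := ((continuous_inv_sqrt_pow hr 3).const_mul (1 - r ^ 2)).intervalIntegrable
    (μ := volume) 0 (π / 2)
  have hderiv : ∀ θ ∈ uIcc 0 (π / 2), HasDerivAt
      (fun θ => r ^ 2 * (sin θ * cos θ) * (√(1 - (r * sin θ) ^ 2))⁻¹)
      (√(1 - (r * sin θ) ^ 2) - (1 - r ^ 2) * (√(1 - (r * sin θ) ^ 2))⁻¹ ^ 3) θ := by
    intro θ _
    have hd := sqrt_one_sub_sq_sin_pos hr θ
    have hs : √(1 - (r * sin θ) ^ 2) ^ 2 = 1 - (r * sin θ) ^ 2 :=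
      sq_sqrt (by linarith [sq_mul_sin_lt_one hr θ])
    have hc : cos θ ^ 2 = 1 - sin θ ^ 2 := by linarith [sin_sq_add_cos_sq θ]
    have hI := (hasDerivAt_inv_sqrt_one_sub (sq_mul_sin_lt_one hr θ)).comp θ
      (((hasDerivAt_sin θ).const_mul r).pow 2)
    refine ((((hasDerivAt_sin θ).mul (hasDerivAt_cos θ)).const_mul (r ^ 2)).mul hI).congr_deriv ?_
    simp only [Function.comp]
    generalize √(1 - (r * sin θ) ^ 2) = d at *
    have hs4 : d ^ 4 = (1 - (r * sin θ) ^ 2) ^ 2 := by rw [← hs]; ring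
    field_simp
    simp only [Nat.cast_ofNat, Nat.add_one_sub_one, pow_one, Pi.mul_apply, hs, hs4]
    ring_nf
    rw [hc]
    ring
  have := intervalIntegral.integral_eq_sub_of_hasDerivAt hderiv (hE.sub h3)
  rw [intervalIntegral.integral_sub hE h3, intervalIntegral.integral_const_mul] at this
  simp only [sin_zero, cos_pi_div_two] at this
  rw [ellipticE]
  linarith

theorem hasDerivAt_ellipticK_integral {r : ℝ} (hr : |r| < 1) :
    HasDerivAt ellipticK (∫ θ in (0 : ℝ)..π / 2,
      1 / (2 * √(1 - (r * sin θ) ^ 2) ^ 3) * (2 * r * sin θ ^ 2)) r := by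
  rw [funext ellipticK_eq_integral_sin]
  exact hasDerivAt_integral_sq_mul_sin (f := fun x => (√(1 - x))⁻¹)
    (fun x hx => hasDerivAt_inv_sqrt_one_sub hx) (continuousOn_const.div (by fun_prop)
      fun x hx => mul_ne_zero two_ne_zero (pow_ne_zero 3 (sqrt_one_sub_ne_zero hx)))
      hr

theorem continuousAt_ellipticK {r : ℝ} (hr : |r| < 1) : ContinuousAt ellipticK r :=
  (hasDerivAt_ellipticK_integral hr).continuousAt

theorem continuousAt_ellipticE {r : ℝ} (hr : |r| < 1) : ContinuousAt ellipticE r :=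
  (hasDerivAt_integral_sq_mul_sin (f := fun x => √(1 - x))
    (fun x hx => hasDerivAt_sqrt_one_sub hx) (continuousOn_const.div (by fun_prop)
      fun x hx => mul_ne_zero two_ne_zero (sqrt_one_sub_ne_zero hx)) hr).continuousAt

theorem hasDerivAt_ellipticK {r : ℝ} (h0 : 0 < r) (h1 : r < 1) :
    HasDerivAt ellipticK ((ellipticE r - (1 - r ^ 2) * ellipticK r) / (r * (1 - r ^ 2))) r := by
  have hr : |r| < 1 := by rwa [abs_of_pos h0]
  have hp : 0 < 1 - r ^ 2 := by nlinarith
  refine (hasDerivAt_ellipticK_integral hr).congr_deriv ?_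
  have hi := (continuous_inv_sqrt_pow hr 1).intervalIntegrable (μ := volume) 0 (π / 2)
  simp only [pow_one] at hi
  have h3 := (continuous_inv_sqrt_pow hr 3).intervalIntegrable (μ := volume) 0 (π / 2)
  rw [← one_sub_sq_mul_integral_inv_sqrt_pow_three hr, ellipticK_eq_integral_sin, ← mul_sub,
    mul_comm r, mul_div_mul_left _ _ hp.ne', eq_div_iff h0.ne',
    ← intervalIntegral.integral_sub h3 hi, ← intervalIntegral.integral_mul_const]
  refine intervalIntegral.integral_congr fun θ _ => ?_
  have hd := sqrt_one_sub_sq_sin_pos hr θ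
  have hs : √(1 - (r * sin θ) ^ 2) ^ 2 = 1 - (r * sin θ) ^ 2 :=
    sq_sqrt (by linarith [sq_mul_sin_lt_one hr θ])
  generalize √(1 - (r * sin θ) ^ 2) = d at *
  field_simp
  rw [hs]
  ring

/-! ### Inequalities between the elliptic integrals -/

theorem ellipticK_pos {r : ℝ} (hr : |r| < 1) : 0 < ellipticK r := by
  rw [ellipticK_eq_integral_sin]
  have hi := (continuous_inv_sqrt_pow hr 1).intervalIntegrable (μ := volume) 0 (π / 2)
  simp only [pow_one] at hi
  exact intervalIntegral.intervalIntegral_pos_of_pos hi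
    (fun θ => inv_pos.2 (sqrt_one_sub_sq_sin_pos hr θ)) (by positivity)

theorem ellipticE_pos {r : ℝ} (hr : |r| < 1) : 0 < ellipticE r :=
  intervalIntegral.intervalIntegral_pos_of_pos
    ((continuous_sqrt_one_sub_sq_sin r).intervalIntegrable _ _)
    (fun θ => sqrt_one_sub_sq_sin_pos hr θ) (by positivity)

theorem sqrt_one_sub_sq_sin_lt_one {r θ : ℝ} (h0 : 0 < r) (hθ : θ ∈ Ioo 0 (π / 2)) :
    √(1 - (r * sin θ) ^ 2) < 1 := by
  have hsin : 0 < sin θ := sin_pos_of_pos_of_lt_pi hθ.1 (by linarith [hθ.2, pi_pos])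
  have : 0 < (r * sin θ) ^ 2 := by positivity
  rw [sqrt_lt' one_pos]
  linarith

theorem ellipticE_lt_ellipticK {r : ℝ} (h0 : 0 < r) (h1 : r < 1) :
    ellipticE r < ellipticK r := by
  have hr : |r| < 1 := by rwa [abs_of_pos h0]
  have hi := (continuous_inv_sqrt_pow hr 1).intervalIntegrable (μ := volume) 0 (π / 2)
  have hE := (continuous_sqrt_one_sub_sq_sin r).intervalIntegrable (μ := volume) 0 (π / 2)
  simp only [pow_one] at hi
  rw [← sub_pos, ellipticK_eq_integral_sin, ellipticE, ← intervalIntegral.integral_sub hi hE]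
  refine intervalIntegral.intervalIntegral_pos_of_pos_on (hi.sub hE) (fun θ hθ => ?_)
    (by positivity)
  have hd := sqrt_one_sub_sq_sin_pos hr θ
  have hd1 := sqrt_one_sub_sq_sin_lt_one h0 hθ
  exact sub_pos.2 (hd1.trans ((one_lt_inv₀ hd).2 hd1))

theorem one_sub_sq_mul_ellipticK_lt_ellipticE {r : ℝ} (h0 : 0 < r) (h1 : r < 1) :
    (1 - r ^ 2) * ellipticK r < ellipticE r := by
  have hr : |r| < 1 := by rwa [abs_of_pos h0]
  have hi := (continuous_inv_sqrt_pow hr 1).intervalIntegrable (μ := volume) 0 (π / 2)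
  have h3 := (continuous_inv_sqrt_pow hr 3).intervalIntegrable (μ := volume) 0 (π / 2)
  simp only [pow_one] at hi
  rw [← one_sub_sq_mul_integral_inv_sqrt_pow_three hr, ellipticK_eq_integral_sin]
  refine mul_lt_mul_of_pos_left ?_ (by nlinarith)
  rw [← sub_pos, ← intervalIntegral.integral_sub h3 hi]
  refine intervalIntegral.intervalIntegral_pos_of_pos_on (h3.sub hi) (fun θ hθ => ?_)
    (by positivity)
  have hd := (one_lt_inv₀ (sqrt_one_sub_sq_sin_pos hr θ)).2 (sqrt_one_sub_sq_sin_lt_one h0 hθ)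
  exact sub_pos.2 (lt_self_pow₀ hd (by norm_num))

/-- The integral over `[0, π/2]` of `Δ⁻³ + Δ - 2 Δ⁻¹ = Δ⁻³ (1 - Δ²)² > 0`, multiplied by
`1 - r²`. -/
theorem two_mul_one_sub_sq_mul_ellipticK_lt {r : ℝ} (h0 : 0 < r) (h1 : r < 1) :
    2 * (1 - r ^ 2) * ellipticK r < (2 - r ^ 2) * ellipticE r := by
  have hr : |r| < 1 := by rwa [abs_of_pos h0]
  have hp : 0 < 1 - r ^ 2 := by nlinarith
  have hi := (continuous_inv_sqrt_pow hr 1).intervalIntegrable (μ := volume) 0 (π / 2)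
  have h3 := (continuous_inv_sqrt_pow hr 3).intervalIntegrable (μ := volume) 0 (π / 2)
  have hE := (continuous_sqrt_one_sub_sq_sin r).intervalIntegrable (μ := volume) 0 (π / 2)
  simp only [pow_one] at hi
  have key : 0 < (∫ θ in (0 : ℝ)..π / 2, (√(1 - (r * sin θ) ^ 2))⁻¹ ^ 3) + ellipticE r
      - 2 * ellipticK r := by
    rw [ellipticE, ellipticK_eq_integral_sin, ← intervalIntegral.integral_const_mul,
      ← intervalIntegral.integral_add h3 hE,
      ← intervalIntegral.integral_sub (h3.add hE) (hi.const_mul 2)]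
    refine intervalIntegral.intervalIntegral_pos_of_pos_on
      ((h3.add hE).sub (hi.const_mul 2)) (fun θ hθ => ?_) (by positivity)
    have hd := sqrt_one_sub_sq_sin_pos hr θ
    have hd1 := sqrt_one_sub_sq_sin_lt_one h0 hθ
    generalize √(1 - (r * sin θ) ^ 2) = d at *
    have : d⁻¹ ^ 3 + d - 2 * d⁻¹ = d⁻¹ ^ 3 * (1 - d ^ 2) ^ 2 := by
      field_simp
      ring
    have h2 : 0 < 1 - d ^ 2 := by nlinarith
    rw [this]
    positivity
  have h := one_sub_sq_mul_integral_inv_sqrt_pow_three hr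
  have := mul_pos hp key
  nlinarith

/-- The singularity of `𝒦` at `1` is weak enough that `r 𝒦(r') → 0` as `r → 0`: in the
trigonometric form the integrand of `r 𝒦(r')` is bounded by `1` and tends to `0`. -/
theorem tendsto_mul_ellipticK_compl :
    Tendsto (fun r => r * ellipticK √(1 - r ^ 2)) (𝓝[>] 0) (𝓝 0) := by
  have hmem : ∀ᶠ r : ℝ in 𝓝[>] 0, r ∈ Ioo (0 : ℝ) 1 := Ioo_mem_nhdsGT one_pos
  have hval : ∀ r ∈ Ioo (0 : ℝ) 1, ∀ θ, 1 - (√(1 - r ^ 2) * sin θ) ^ 2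
      = cos θ ^ 2 + r ^ 2 * sin θ ^ 2 := by
    intro r hr θ
    rw [mul_pow, sq_sqrt (by nlinarith [hr.1, hr.2])]
    linarith [sin_sq_add_cos_sq θ]
  have h : Tendsto (fun r : ℝ => ∫ θ in (0 : ℝ)..π / 2, r / √(cos θ ^ 2 + r ^ 2 * sin θ ^ 2))
      (𝓝[>] 0) (𝓝 (∫ θ in (0 : ℝ)..π / 2, 0)) := by
    refine intervalIntegral.tendsto_integral_filter_of_dominated_convergence (fun _ => 1) ?_ ?_
      intervalIntegrable_const ?_
    · exact Eventually.of_forall fun r => Measurable.aestronglyMeasurable (by fun_prop)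
    · filter_upwards [hmem] with r hr
      refine Eventually.of_forall fun θ _ => ?_
      rw [norm_eq_abs, abs_of_nonneg (div_nonneg hr.1.le (sqrt_nonneg _))]
      refine div_le_one_of_le₀ (le_sqrt_of_sq_le ?_) (sqrt_nonneg _)
      nlinarith [sin_sq_add_cos_sq θ, sq_nonneg (cos θ), hr.1, hr.2, mul_pos hr.1 hr.1,
        mul_nonneg (sq_nonneg (cos θ)) (show 0 ≤ 1 - r ^ 2 by nlinarith [hr.1, hr.2])]
    · have hne : ∀ᵐ θ : ℝ, θ ≠ π / 2 := Measure.ae_ne volume _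
      filter_upwards [hne] with θ hθ hmem
      rw [uIoc_of_le (by positivity)] at hmem
      have hc : 0 < cos θ := cos_pos_of_mem_Ioo
        ⟨by linarith [hmem.1, pi_pos], lt_of_le_of_ne hmem.2 hθ⟩
      have hcont : ContinuousAt (fun r : ℝ => r / √(cos θ ^ 2 + r ^ 2 * sin θ ^ 2)) 0 := by
        refine ContinuousAt.div (by fun_prop) (by fun_prop) ?_
        exact (sqrt_pos.2 (by positivity)).ne'
      simpa using hcont.tendsto.mono_left nhdsWithin_le_nhds
  rw [intervalIntegral.integral_zero] at h
  refine h.congr' ?_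
  filter_upwards [hmem] with r hr
  rw [ellipticK_eq_integral_sin, ← intervalIntegral.integral_const_mul]
  refine intervalIntegral.integral_congr fun θ _ => ?_
  simp only [hval r hr θ, div_eq_mul_inv]

/-! ### The complementary modulus and Legendre's relation -/

theorem compl_mem_Ioo {r : ℝ} (hr : r ∈ Ioo (0 : ℝ) 1) : √(1 - r ^ 2) ∈ Ioo (0 : ℝ) 1 := by
  refine ⟨sqrt_pos.2 (by nlinarith [hr.1, hr.2]), ?_⟩
  rw [sqrt_lt' one_pos]
  nlinarith [hr.1]

theorem sq_compl {r : ℝ} (hr : r ∈ Ioo (0 : ℝ) 1) : √(1 - r ^ 2) ^ 2 = 1 - r ^ 2 :=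
  sq_sqrt (by nlinarith [hr.1, hr.2])

theorem abs_lt_one_of_mem {r : ℝ} (hr : r ∈ Ioo (0 : ℝ) 1) : |r| < 1 := by
  rw [abs_of_pos hr.1]
  exact hr.2

theorem hasDerivAt_compl {r : ℝ} (hr : r ∈ Ioo (0 : ℝ) 1) :
    HasDerivAt (fun r => √(1 - r ^ 2)) (-r / √(1 - r ^ 2)) r := by
  refine (((hasDerivAt_pow 2 r).const_sub 1).sqrt ?_).congr_deriv ?_
  · nlinarith [hr.1, hr.2]
  · have := (compl_mem_Ioo hr).1
    simp only [Nat.cast_ofNat, Nat.add_one_sub_one, pow_one]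
    field_simp

theorem hasDerivAt_ellipticK_compl {r : ℝ} (hr : r ∈ Ioo (0 : ℝ) 1) :
    HasDerivAt (fun r => ellipticK √(1 - r ^ 2))
      (-(ellipticE √(1 - r ^ 2) - r ^ 2 * ellipticK √(1 - r ^ 2)) / (r * (1 - r ^ 2))) r := by
  have hs := compl_mem_Ioo hr
  refine ((hasDerivAt_ellipticK hs.1 hs.2).comp r (hasDerivAt_compl hr)).congr_deriv ?_
  have h1 : 0 < 1 - r ^ 2 := by nlinarith [hr.1, hr.2]
  have := sq_compl hr
  have h0 := hr.1
  have h2 := hs.1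
  rw [sq_compl hr, sub_sub_cancel]
  generalize √(1 - r ^ 2) = p at *
  rw [← this]
  field_simp

theorem hasDerivAt_ellipticE_compl {r : ℝ} (hr : r ∈ Ioo (0 : ℝ) 1) :
    HasDerivAt (fun r => ellipticE √(1 - r ^ 2))
      (r * (ellipticK √(1 - r ^ 2) - ellipticE √(1 - r ^ 2)) / (1 - r ^ 2)) r := by
  have hs := compl_mem_Ioo hr
  refine ((hasDerivAt_ellipticE hs.1 hs.2).comp r (hasDerivAt_compl hr)).congr_deriv ?_
  have h0 := hs.1
  nth_rewrite 7 [← sq_compl hr]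
  field_simp
  ring

/-- The left-hand side `ℰ'𝒦 + ℰ𝒦' - 𝒦𝒦'` of Legendre's relation, where `𝒦'` and `ℰ'` are the values
of the elliptic integrals at the complementary modulus `√(1 - r²)`. -/
noncomputable def legendreExpr (r : ℝ) : ℝ :=
  ellipticE √(1 - r ^ 2) * ellipticK r + ellipticE r * ellipticK √(1 - r ^ 2)
    - ellipticK r * ellipticK √(1 - r ^ 2)

/-- Legendre's relation, without the value `π / 2` of the constant: the derivative vanishes, and
`𝒦 (ℰ' - r² 𝒦') + 𝒦' (ℰ - r'² 𝒦)` is a sum of positive terms. -/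
theorem exists_legendreExpr_eq : ∃ c > 0, ∀ r ∈ Ioo (0 : ℝ) 1, legendreExpr r = c := by
  have hderiv : ∀ r ∈ Ioo (0 : ℝ) 1, HasDerivAt legendreExpr 0 r := by
    intro r hr
    have hK := hasDerivAt_ellipticK hr.1 hr.2
    have hE := hasDerivAt_ellipticE hr.1 hr.2
    have hK' := hasDerivAt_ellipticK_compl hr
    have hE' := hasDerivAt_ellipticE_compl hr
    refine (((hE'.mul hK).add (hE.mul hK')).sub (hK.mul hK')).congr_deriv ?_
    have h1 : 1 - r ^ 2 ≠ 0 := by nlinarith [hr.1, hr.2]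
    have h0 := hr.1.ne'
    field_simp
    ring
  have hhalf : (1 / 2 : ℝ) ∈ Ioo (0 : ℝ) 1 := by norm_num
  refine ⟨legendreExpr (1 / 2), ?_, fun r hr => ?_⟩
  · have hs := compl_mem_Ioo hhalf
    have h1 := one_sub_sq_mul_ellipticK_lt_ellipticE hhalf.1 hhalf.2
    have h2 := one_sub_sq_mul_ellipticK_lt_ellipticE hs.1 hs.2
    have h3 := ellipticK_pos (abs_lt_one_of_mem hhalf)
    have h4 := ellipticK_pos (abs_lt_one_of_mem hs)
    rw [sq_compl hhalf] at h2
    rw [legendreExpr]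
    nlinarith [mul_pos (sub_pos.2 h1) h4, mul_pos (sub_pos.2 h2) h3]
  · exact isOpen_Ioo.is_const_of_deriv_eq_zero isPreconnected_Ioo
      (fun x hx => (hderiv x hx).differentiableAt.differentiableWithinAt)
      (fun x hx => (hderiv x hx).deriv) hr hhalf

/-! ### Monotonicity of `r 𝒦² / artanh r` and `r 𝒦 𝒦' / artanh r` -/

theorem hasDerivAt_artanh {r : ℝ} (hr : r ∈ Ioo (-1 : ℝ) 1) :
    HasDerivAt artanh (1 / (1 - r ^ 2)) r := by
  have h1 : 0 < 1 - r := by linarith [hr.2]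
  have h2 : 0 < 1 + r := by linarith [hr.1]
  have h : HasDerivAt (fun x : ℝ => 1 / 2 * log ((1 + x) / (1 - x))) (1 / (1 - r ^ 2)) r := by
    refine (((((hasDerivAt_id r).const_add 1).div ((hasDerivAt_id r).const_sub 1) h1.ne').log
      (div_pos h2 h1).ne').const_mul (1 / 2)).congr_deriv ?_
    have h3 : 1 - r ^ 2 = (1 - r) * (1 + r) := by ring
    simp only [id, h3, Pi.div_apply]
    field_simp
    ring
  refine h.congr_of_eventuallyEq ?_
  filter_upwards [Ioo_mem_nhds hr.1 hr.2] with x hx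
  exact artanh_eq_half_log ⟨hx.1.le, hx.2.le⟩

/-- A monotone form of l'Hôpital's rule on `(0, 1)` with denominator `artanh`: if
`f' = F · artanh'` with `F` strictly increasing, and `F · artanh - f → 0` at `0`, then
`f / artanh` is strictly increasing. -/
theorem strictMonoOn_div_artanh {f F F' : ℝ → ℝ}
    (hf : ∀ r ∈ Ioo (0 : ℝ) 1, HasDerivAt f (F r / (1 - r ^ 2)) r)
    (hF : ∀ r ∈ Ioo (0 : ℝ) 1, HasDerivAt F (F' r) r) (hF' : ∀ r ∈ Ioo (0 : ℝ) 1, 0 < F' r)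
    (h0 : Tendsto (fun r => F r * artanh r - f r) (𝓝[>] 0) (𝓝 0)) :
    StrictMonoOn (fun r => f r / artanh r) (Ioo 0 1) := by
  have hart : ∀ r ∈ Ioo (0 : ℝ) 1, HasDerivAt artanh (1 / (1 - r ^ 2)) r :=
    fun r hr => hasDerivAt_artanh ⟨by linarith [hr.1], hr.2⟩
  have hW : ∀ r ∈ Ioo (0 : ℝ) 1,
      HasDerivAt (fun r => F r * artanh r - f r) (F' r * artanh r) r := fun r hr => by
    refine (((hF r hr).mul (hart r hr)).sub (hf r hr)).congr_deriv ?_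
    ring
  have hWmono : StrictMonoOn (fun r => F r * artanh r - f r) (Ioo 0 1) := by
    refine strictMonoOn_of_deriv_pos (convex_Ioo 0 1)
      (fun x hx => (hW x hx).continuousAt.continuousWithinAt) fun x hx => ?_
    rw [interior_Ioo] at hx
    rw [(hW x hx).deriv]
    exact mul_pos (hF' x hx) (artanh_pos hx)
  have hWpos : ∀ r ∈ Ioo (0 : ℝ) 1, 0 < F r * artanh r - f r := by
    intro r hr
    have hr2 : r / 2 ∈ Ioo (0 : ℝ) 1 := ⟨by linarith [hr.1], by linarith [hr.1, hr.2]⟩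
    refine lt_of_le_of_lt (le_of_tendsto h0 ?_) (hWmono hr2 hr (by linarith [hr.1]))
    filter_upwards [Ioo_mem_nhdsGT hr2.1] with x hx
    exact (hWmono ⟨hx.1, hx.2.trans hr2.2⟩ hr2 hx.2).le
  refine strictMonoOn_of_deriv_pos (convex_Ioo 0 1) (fun x hx => ((hf x hx).div (hart x hx)
    (artanh_pos hx).ne').continuousAt.continuousWithinAt) fun x hx => ?_
  rw [interior_Ioo] at hx
  have hx1 : 0 < 1 - x ^ 2 := by nlinarith [hx.1, hx.2]
  have ha := artanh_pos hx
  have : F x / (1 - x ^ 2) * artanh x - f x * (1 / (1 - x ^ 2))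
      = (F x * artanh x - f x) / (1 - x ^ 2) := by ring
  rw [((hf x hx).fun_div (hart x hx) ha.ne').deriv, this]
  exact div_pos (div_pos (hWpos x hx) hx1) (by positivity)

theorem hasDerivAt_two_mul_ellipticE_sub {r : ℝ} (hr : r ∈ Ioo (0 : ℝ) 1) :
    HasDerivAt (fun r => 2 * ellipticE r - (1 - r ^ 2) * ellipticK r)
      ((ellipticE r - (1 - r ^ 2) * ellipticK r) / r) r := by
  have h1 : 1 - r ^ 2 ≠ 0 := by nlinarith [hr.1, hr.2]
  have h0 := hr.1.ne'
  refine (((hasDerivAt_ellipticE hr.1 hr.2).const_mul 2).sub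
    (((hasDerivAt_pow 2 r).const_sub 1).mul (hasDerivAt_ellipticK hr.1 hr.2))).congr_deriv ?_
  simp only [Nat.cast_ofNat, Nat.add_one_sub_one, pow_one]
  field_simp
  ring

theorem tendsto_artanh_zero : Tendsto artanh (𝓝[>] 0) (𝓝 0) := by
  have := (hasDerivAt_artanh (r := 0) (by norm_num)).continuousAt.tendsto
  rw [artanh_zero] at this
  exact this.mono_left nhdsWithin_le_nhds

theorem tendsto_ellipticK_zero : Tendsto ellipticK (𝓝[>] 0) (𝓝 (ellipticK 0)) :=
  (continuousAt_ellipticK (by simp)).tendsto.mono_left nhdsWithin_le_nhds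

theorem tendsto_ellipticE_zero : Tendsto ellipticE (𝓝[>] 0) (𝓝 (ellipticE 0)) :=
  (continuousAt_ellipticE (by simp)).tendsto.mono_left nhdsWithin_le_nhds

theorem tendsto_id_zero : Tendsto (fun r : ℝ => r) (𝓝[>] 0) (𝓝 0) :=
  tendsto_id.mono_left nhdsWithin_le_nhds

/-- Here `(1 - r²) (r 𝒦²)' = 𝒦 (2ℰ - r'² 𝒦)`, a product of two increasing functions. -/
theorem strictMonoOn_mul_ellipticK_sq_div_artanh :
    StrictMonoOn (fun r => r * ellipticK r ^ 2 / artanh r) (Ioo 0 1) := by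
  refine strictMonoOn_div_artanh (f := fun r => r * ellipticK r ^ 2)
    (F := fun r => ellipticK r * (2 * ellipticE r - (1 - r ^ 2) * ellipticK r)) (fun r hr => ?_)
    (fun r hr => (hasDerivAt_ellipticK hr.1 hr.2).mul (hasDerivAt_two_mul_ellipticE_sub hr))
    (fun r hr => ?_) ?_
  · have h1 : 1 - r ^ 2 ≠ 0 := by nlinarith [hr.1, hr.2]
    have h0 := hr.1.ne'
    refine ((hasDerivAt_id r).mul ((hasDerivAt_ellipticK hr.1 hr.2).pow 2)).congr_deriv ?_
    simp only [Nat.cast_ofNat, Nat.add_one_sub_one, pow_one, id, Pi.pow_apply]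
    field_simp
    ring
  · have h1 : 0 < 1 - r ^ 2 := by nlinarith [hr.1, hr.2]
    have h0 := hr.1
    have hK := ellipticK_pos (abs_lt_one_of_mem hr)
    have hE := ellipticE_pos (abs_lt_one_of_mem hr)
    have ha := sub_pos.2 (one_sub_sq_mul_ellipticK_lt_ellipticE hr.1 hr.2)
    have hb : 0 < 2 * ellipticE r - (1 - r ^ 2) * ellipticK r := by linarith
    positivity
  · have h : Tendsto (fun r => ellipticK r * (2 * ellipticE r - (1 - r ^ 2) * ellipticK r)
        * artanh r - r * ellipticK r ^ 2) (𝓝[>] 0)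
        (𝓝 (ellipticK 0 * (2 * ellipticE 0 - (1 - 0 ^ 2) * ellipticK 0) * 0
          - 0 * ellipticK 0 ^ 2)) :=
      ((tendsto_ellipticK_zero.mul ((tendsto_ellipticE_zero.const_mul 2).sub
        (((tendsto_id_zero.pow 2).const_sub 1).mul tendsto_ellipticK_zero))).mul
        tendsto_artanh_zero).sub (tendsto_id_zero.mul (tendsto_ellipticK_zero.pow 2))
    simpa using h

/-- The derivative of `(2ℰ - r'² 𝒦) 𝒦'` is negative on `(0, 1)`. -/
theorem deriv_two_mul_ellipticE_sub_mul_ellipticK_compl_neg {r : ℝ} (hr : r ∈ Ioo (0 : ℝ) 1) :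
    (ellipticE r - (1 - r ^ 2) * ellipticK r) / r * ellipticK √(1 - r ^ 2)
      + (2 * ellipticE r - (1 - r ^ 2) * ellipticK r)
        * (-(ellipticE √(1 - r ^ 2) - r ^ 2 * ellipticK √(1 - r ^ 2)) / (r * (1 - r ^ 2))) < 0 := by
  have hs := compl_mem_Ioo hr
  have h1 : 0 < 1 - r ^ 2 := by nlinarith [hr.1, hr.2]
  have h0 := hr.1
  have hEK := ellipticE_lt_ellipticK hr.1 hr.2
  have ha := one_sub_sq_mul_ellipticK_lt_ellipticE hr.1 hr.2
  have hb := one_sub_sq_mul_ellipticK_lt_ellipticE hs.1 hs.2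
  have hc := two_mul_one_sub_sq_mul_ellipticK_lt hs.1 hs.2
  rw [sq_compl hr] at hb hc
  generalize ellipticK √(1 - r ^ 2) = K' at *
  generalize ellipticE √(1 - r ^ 2) = E' at *
  generalize ellipticK r = K at *
  generalize ellipticE r = E at *
  -- With `a = ℰ - r'² 𝒦` and `b = ℰ' - r² 𝒦'` the claim `r'² a 𝒦' < (ℰ + a) b` becomes
  -- `a (𝒦' - ℰ') < ℰ b`. Now `hc` reads `r² (𝒦' - ℰ') < b`, and `a < r² ℰ` is `ℰ < 𝒦`.
  have h2 : (1 - r ^ 2) * (E - (1 - r ^ 2) * K) * K'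
      < (2 * E - (1 - r ^ 2) * K) * (E' - r ^ 2 * K') := by
    have e1 : 0 < (E - (1 - r ^ 2) * K) * ((E' - r ^ 2 * K') - r ^ 2 * (K' - E')) :=
      mul_pos (by linarith) (by nlinarith)
    have e2 : 0 < (E' - r ^ 2 * K') * ((1 - r ^ 2) * (K - E)) :=
      mul_pos (by nlinarith) (mul_pos h1 (by linarith))
    have e3 : 0 < r ^ 2 := by positivity
    have : 0 < r ^ 2 * ((2 * E - (1 - r ^ 2) * K) * (E' - r ^ 2 * K')
      - (1 - r ^ 2) * (E - (1 - r ^ 2) * K) * K') := by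
      linear_combination e1 + e2
    linarith [pos_of_mul_pos_right this e3.le]
  have h3 : (E - (1 - r ^ 2) * K) / r * K'
      + (2 * E - (1 - r ^ 2) * K) * (-(E' - r ^ 2 * K') / (r * (1 - r ^ 2)))
      = ((1 - r ^ 2) * (E - (1 - r ^ 2) * K) * K' - (2 * E - (1 - r ^ 2) * K) * (E' - r ^ 2 * K'))
        / (r * (1 - r ^ 2)) := by
    field_simp
    ring
  rw [h3]
  exact div_neg_of_neg_of_pos (by linarith) (by positivity)

/-- Here `(1 - r²) (r 𝒦 𝒦')'` equals `(2ℰ - r'² 𝒦) 𝒦'` minus the Legendre constant, which is a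
decreasing function. -/
theorem strictAntiOn_mul_ellipticK_mul_ellipticK_compl_div_artanh :
    StrictAntiOn (fun r => r * (ellipticK r * ellipticK √(1 - r ^ 2)) / artanh r) (Ioo 0 1) := by
  obtain ⟨c, -, hc⟩ := exists_legendreExpr_eq
  have h : StrictMonoOn (fun r => -(r * (ellipticK r * ellipticK √(1 - r ^ 2))) / artanh r)
      (Ioo 0 1) := by
    refine strictMonoOn_div_artanh
      (f := fun r => -(r * (ellipticK r * ellipticK √(1 - r ^ 2))))
      (F := fun r => c - (2 * ellipticE r - (1 - r ^ 2) * ellipticK r) * ellipticK √(1 - r ^ 2))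
      (fun r hr => ?_)
      (fun r hr => ((hasDerivAt_two_mul_ellipticE_sub hr).mul
        (hasDerivAt_ellipticK_compl hr)).const_sub c)
      (fun r hr => neg_pos.2 (deriv_two_mul_ellipticE_sub_mul_ellipticK_compl_neg hr)) ?_
    · have h1 : 1 - r ^ 2 ≠ 0 := by nlinarith [hr.1, hr.2]
      have h0 := hr.1.ne'
      refine ((hasDerivAt_id r).mul ((hasDerivAt_ellipticK hr.1 hr.2).mul
        (hasDerivAt_ellipticK_compl hr))).neg.congr_deriv ?_
      rw [← hc r hr, legendreExpr]
      simp only [id, Pi.mul_apply]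
      field_simp
      ring
    -- `𝒦'` is infinite at `0`, so the factor `r` of `r 𝒦'` is taken from `artanh r`
    · have hK' := tendsto_mul_ellipticK_compl
      have hart : Tendsto (fun r => artanh r / r) (𝓝[>] 0) (𝓝 1) := by
        have := (hasDerivAt_artanh (r := 0) (by norm_num)).tendsto_slope_zero_right
        simpa [div_eq_inv_mul] using this
      have hlim : Tendsto (fun r => c * artanh r -
          (2 * ellipticE r - (1 - r ^ 2) * ellipticK r) * (r * ellipticK √(1 - r ^ 2))
            * (artanh r / r) + ellipticK r * (r * ellipticK √(1 - r ^ 2))) (𝓝[>] 0)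
          (𝓝 (c * 0 - (2 * ellipticE 0 - (1 - 0 ^ 2) * ellipticK 0) * 0 * 1
            + ellipticK 0 * 0)) :=
        ((tendsto_artanh_zero.const_mul c).sub ((((tendsto_ellipticE_zero.const_mul 2).sub
          (((tendsto_id_zero.pow 2).const_sub 1).mul tendsto_ellipticK_zero)).mul hK').mul
          hart)).add (tendsto_ellipticK_zero.mul hK')
      simp only [mul_zero, zero_mul, sub_zero, add_zero] at hlim
      refine hlim.congr' ?_
      filter_upwards [self_mem_nhdsWithin] with r hr
      have hr0 : r ≠ 0 := (mem_Ioi.1 hr).ne'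
      field_simp
      ring
  intro x hx y hy hxy
  have := h hx hy hxy
  simp only [neg_div] at this
  exact neg_lt_neg_iff.1 this

/-! ### The function `μ` and its inverse -/

theorem hasDerivAt_modulusMu {c r : ℝ} (hc : legendreExpr r = c) (hr : r ∈ Ioo (0 : ℝ) 1) :
    HasDerivAt modulusMu (-(π / 2 * c / (r * (1 - r ^ 2) * ellipticK r ^ 2))) r := by
  have h1 : 1 - r ^ 2 ≠ 0 := by nlinarith [hr.1, hr.2]
  have h0 := hr.1.ne'
  have hK := (ellipticK_pos (abs_lt_one_of_mem hr)).ne'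
  refine (((hasDerivAt_ellipticK_compl hr).div (hasDerivAt_ellipticK hr.1 hr.2) hK).const_mul
    (π / 2)).congr_deriv ?_
  rw [← hc, legendreExpr]
  field_simp
  ring

theorem continuousOn_modulusMu : ContinuousOn modulusMu (Ioo 0 1) := fun _ hx =>
  (hasDerivAt_modulusMu rfl hx).continuousAt.continuousWithinAt

theorem strictAntiOn_modulusMu : StrictAntiOn modulusMu (Ioo 0 1) := by
  obtain ⟨c, hc0, hc⟩ := exists_legendreExpr_eq
  refine strictAntiOn_of_deriv_neg (convex_Ioo 0 1) continuousOn_modulusMu fun x hx => ?_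
  rw [interior_Ioo] at hx
  have h1 : 0 < 1 - x ^ 2 := by nlinarith [hx.1, hx.2]
  have h0 := hx.1
  have hK := ellipticK_pos (abs_lt_one_of_mem hx)
  rw [(hasDerivAt_modulusMu (hc x hx) hx).deriv]
  exact neg_neg_of_pos (by positivity)

theorem modulusMu_pos {r : ℝ} (hr : r ∈ Ioo (0 : ℝ) 1) : 0 < modulusMu r :=
  mul_pos (by positivity) (div_pos (ellipticK_pos (abs_lt_one_of_mem (compl_mem_Ioo hr)))
    (ellipticK_pos (abs_lt_one_of_mem hr)))

theorem modulusMu_mul_modulusMu_compl {r : ℝ} (hr : r ∈ Ioo (0 : ℝ) 1) :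
    modulusMu r * modulusMu √(1 - r ^ 2) = (π / 2) ^ 2 := by
  have h1 := (ellipticK_pos (abs_lt_one_of_mem hr)).ne'
  have h2 := (ellipticK_pos (abs_lt_one_of_mem (compl_mem_Ioo hr))).ne'
  rw [modulusMu, modulusMu, sq_compl hr, sub_sub_cancel, sqrt_sq hr.1.le]
  field_simp

theorem strictMonoOn_ellipticK : StrictMonoOn ellipticK (Ioo 0 1) := by
  refine strictMonoOn_of_deriv_pos (convex_Ioo 0 1) (fun x hx =>
    (continuousAt_ellipticK (abs_lt_one_of_mem hx)).continuousWithinAt) fun x hx => ?_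
  rw [interior_Ioo] at hx
  have h1 : 0 < 1 - x ^ 2 := by nlinarith [hx.1, hx.2]
  rw [(hasDerivAt_ellipticK hx.1 hx.2).deriv]
  exact div_pos (sub_pos.2 (one_sub_sq_mul_ellipticK_lt_ellipticE hx.1 hx.2)) (mul_pos hx.1 h1)

/-- `𝒦(r)² ≥ C artanh r` for `r` near `1` because `r 𝒦(r)² / artanh r` increases, so `𝒦` is
unbounded while `𝒦(r')` stays bounded. -/
theorem exists_modulusMu_lt {ε : ℝ} (hε : 0 < ε) : ∃ r ∈ Ioo (0 : ℝ) 1, modulusMu r < ε := by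
  have hhalf : (1 / 2 : ℝ) ∈ Ioo (0 : ℝ) 1 := by norm_num
  have hG0 : 0 < 1 / 2 * ellipticK (1 / 2) ^ 2 / artanh (1 / 2) := by
    have := ellipticK_pos (abs_lt_one_of_mem hhalf)
    have := artanh_pos hhalf
    positivity
  have hmono := strictMonoOn_mul_ellipticK_sq_div_artanh
  have hM0 := ellipticK_pos (abs_lt_one_of_mem (compl_mem_Ioo hhalf))
  generalize hC : 1 / 2 * ellipticK (1 / 2) ^ 2 / artanh (1 / 2) = C at hG0
  generalize hM : ellipticK √(1 - (1 / 2) ^ 2) = M at hM0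
  obtain ⟨x, hx⟩ := exists_gt (max (artanh (1 / 2)) ((π / 2 * M) ^ 2 / (C * ε ^ 2)))
  have hx1 := (le_max_left _ _).trans_lt hx
  have hx2 := (le_max_right _ _).trans_lt hx
  have hx0 : 0 < x := (artanh_pos hhalf).trans hx1
  have hr0 : 1 / 2 < tanh x := by
    by_contra! h
    have := artanh_le_artanh (neg_one_lt_tanh x) hhalf.2 h
    rw [artanh_tanh] at this
    linarith
  have hr : tanh x ∈ Ioo (0 : ℝ) 1 := ⟨by linarith, tanh_lt_one x⟩
  refine ⟨tanh x, hr, ?_⟩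
  have h1 := hmono hhalf hr hr0
  have hK0 := ellipticK_pos (abs_lt_one_of_mem hr)
  have hK1 : ellipticK √(1 - tanh x ^ 2) < M := by
    rw [← hM]
    refine strictMonoOn_ellipticK (compl_mem_Ioo hr) (compl_mem_Ioo hhalf) ?_
    exact sqrt_lt_sqrt (by nlinarith [hr.1, hr.2]) (by nlinarith)
  simp only [hC, artanh_tanh] at h1
  rw [lt_div_iff₀ hx0] at h1
  have h2 : C * x < ellipticK (tanh x) ^ 2 :=
    h1.trans_le (mul_le_of_le_one_left (sq_nonneg _) hr.2.le)
  rw [div_lt_iff₀ (by positivity)] at hx2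
  have h3 : (π / 2 * M) ^ 2 < (ε * ellipticK (tanh x)) ^ 2 := by
    have : 0 < ε ^ 2 := by positivity
    nlinarith
  have h4 := lt_of_pow_lt_pow_left₀ 2 (by positivity) h3
  rw [modulusMu, ← mul_div_assoc, div_lt_iff₀ hK0]
  exact (mul_lt_mul_of_pos_left hK1 (by positivity)).trans h4

theorem bijOn_modulusMu : BijOn modulusMu (Ioo 0 1) (Ioi 0) := by
  refine ⟨fun r hr => modulusMu_pos hr, strictAntiOn_modulusMu.injOn, fun y hy => ?_⟩
  rw [mem_Ioi] at hy
  obtain ⟨a, ha, hay⟩ := exists_modulusMu_lt hy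
  obtain ⟨b, hb, hby⟩ := exists_modulusMu_lt (show 0 < (π / 2) ^ 2 / y by positivity)
  have hb' : y < modulusMu √(1 - b ^ 2) := by
    rw [lt_div_iff₀ hy, ← modulusMu_mul_modulusMu_compl hb] at hby
    exact lt_of_mul_lt_mul_left hby (modulusMu_pos hb).le
  exact isPreconnected_Ioo.intermediate_value ha (compl_mem_Ioo hb) continuousOn_modulusMu
    ⟨hay.le, hb'.le⟩

theorem modulusMuInv_mem {y : ℝ} (hy : 0 < y) : modulusMuInv y ∈ Ioo (0 : ℝ) 1 :=
  Function.invFunOn_mem (bijOn_modulusMu.surjOn hy)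

theorem modulusMu_modulusMuInv {y : ℝ} (hy : 0 < y) : modulusMu (modulusMuInv y) = y :=
  Function.invFunOn_eq (bijOn_modulusMu.surjOn hy)

theorem modulusMuInv_modulusMu {r : ℝ} (hr : r ∈ Ioo (0 : ℝ) 1) :
    modulusMuInv (modulusMu r) = r :=
  bijOn_modulusMu.injOn.leftInvOn_invFunOn hr

theorem continuousAt_modulusMuInv {y : ℝ} (hy : 0 < y) : ContinuousAt modulusMuInv y := by
  have hmono : StrictMonoOn (fun y => -modulusMuInv y) (Ioi 0) := by
    intro a ha b hb hab
    refine neg_lt_neg ((strictAntiOn_modulusMu.lt_iff_gt (modulusMuInv_mem ha)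
      (modulusMuInv_mem hb)).1 ?_)
    rwa [modulusMu_modulusMuInv ha, modulusMu_modulusMuInv hb]
  have himg : Ioo (-1) 0 ⊆ (fun y => -modulusMuInv y) '' Ioi 0 := by
    intro x hx
    have hx' : -x ∈ Ioo (0 : ℝ) 1 := ⟨by linarith [hx.2], by linarith [hx.1]⟩
    exact ⟨modulusMu (-x), modulusMu_pos hx', by simp [modulusMuInv_modulusMu hx']⟩
  have hs := modulusMuInv_mem hy
  have := (hmono.continuousAt_of_image_mem_nhds (Ioi_mem_nhds hy)
    (mem_of_superset (Ioo_mem_nhds (by linarith [hs.2]) (by linarith [hs.1])) himg)).neg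
  exact this.congr (Eventually.of_forall fun y => neg_neg (modulusMuInv y))

/-! ### The distortion function `φ_K` -/

theorem phiK_mem {K r : ℝ} (hK : 0 < K) (hr : r ∈ Ioo (0 : ℝ) 1) : phiK K r ∈ Ioo (0 : ℝ) 1 :=
  modulusMuInv_mem (div_pos (modulusMu_pos hr) hK)

theorem modulusMu_phiK {K r : ℝ} (hK : 0 < K) (hr : r ∈ Ioo (0 : ℝ) 1) :
    modulusMu (phiK K r) = modulusMu r / K :=
  modulusMu_modulusMuInv (div_pos (modulusMu_pos hr) hK)

theorem lt_phiK {K r : ℝ} (hK : 1 < K) (hr : r ∈ Ioo (0 : ℝ) 1) : r < phiK K r := by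
  have hK0 : 0 < K := by linarith
  rw [← strictAntiOn_modulusMu.lt_iff_gt (phiK_mem hK0 hr) hr, modulusMu_phiK hK0 hr]
  exact div_lt_self (modulusMu_pos hr) hK

/-- The Legendre constants coming from `μ` at `r` and at `φ_K(r)` cancel, so that only values of
`𝒦` at these two points remain. -/
theorem hasDerivAt_phiK {K r : ℝ} (hK : 0 < K) (hr : r ∈ Ioo (0 : ℝ) 1) :
    HasDerivAt (phiK K) (phiK K r * (1 - phiK K r ^ 2) * ellipticK (phiK K r) ^ 2
      / (K * (r * (1 - r ^ 2) * ellipticK r ^ 2))) r := by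
  obtain ⟨c, hc0, hc⟩ := exists_legendreExpr_eq
  have hy : 0 < modulusMu r / K := div_pos (modulusMu_pos hr) hK
  have hs := phiK_mem hK hr
  have hr1 : 0 < 1 - r ^ 2 := by nlinarith [hr.1, hr.2]
  have hs1 : 0 < 1 - phiK K r ^ 2 := by nlinarith [hs.1, hs.2]
  have hs0 := hs.1
  have hr0 := hr.1
  have hKr := ellipticK_pos (abs_lt_one_of_mem hr)
  have hKs := ellipticK_pos (abs_lt_one_of_mem hs)
  have hinv := HasDerivAt.of_local_left_inverse (continuousAt_modulusMuInv hy)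
    (hasDerivAt_modulusMu (hc _ hs) hs) (neg_ne_zero.2 (by positivity))
    (by filter_upwards [Ioi_mem_nhds hy] with z hz using modulusMu_modulusMuInv hz)
  refine (hinv.comp r ((hasDerivAt_modulusMu (hc r hr) hr).div_const K)).congr_deriv ?_
  rw [← phiK]
  field_simp

theorem hasDerivAt_artanh_phiK {K r : ℝ} (hK : 0 < K) (hr : r ∈ Ioo (0 : ℝ) 1) :
    HasDerivAt (fun r => artanh (phiK K r)) (phiK K r * ellipticK (phiK K r) ^ 2
      / (K * (r * (1 - r ^ 2) * ellipticK r ^ 2))) r := by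
  have hs := phiK_mem hK hr
  have hs1 : 1 - phiK K r ^ 2 ≠ 0 := by nlinarith [hs.1, hs.2]
  refine ((hasDerivAt_artanh ⟨by linarith [hs.1], hs.2⟩).comp r
    (hasDerivAt_phiK hK hr)).congr_deriv ?_
  field_simp

/-- Write `s = φ_K(r) > r`. The sign of the derivative is that of the difference of
`μ(r) · r 𝒦(r)² / artanh r` between `s` and `r`, since `1 / K = μ(s) / μ(r)`. -/
theorem strictAntiOn_artanh_phiK_div_artanh {K : ℝ} (hK : 1 < K) :
    StrictAntiOn (fun r => artanh (phiK K r) / artanh r) (Ioo 0 1) := by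
  have hK0 : 0 < K := by linarith
  have hderiv : ∀ r ∈ Ioo (0 : ℝ) 1, HasDerivAt (fun r => artanh (phiK K r) / artanh r) _ r :=
    fun r hr => (hasDerivAt_artanh_phiK hK0 hr).fun_div
      (hasDerivAt_artanh ⟨by linarith [hr.1], hr.2⟩) (artanh_pos hr).ne'
  refine strictAntiOn_of_deriv_neg (convex_Ioo 0 1) (fun x hx =>
    (hderiv x hx).continuousAt.continuousWithinAt) fun r hr => ?_
  rw [interior_Ioo] at hr
  have hs := phiK_mem hK0 hr
  have hmu := modulusMu_phiK hK0 hr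
  have hH := strictAntiOn_mul_ellipticK_mul_ellipticK_compl_div_artanh hr hs (lt_phiK hK hr)
  have hKr := ellipticK_pos (abs_lt_one_of_mem hr)
  have hKs := ellipticK_pos (abs_lt_one_of_mem hs)
  have hKr' := ellipticK_pos (abs_lt_one_of_mem (compl_mem_Ioo hr))
  have har := artanh_pos hr
  have has := artanh_pos hs
  have hr1 : 0 < 1 - r ^ 2 := by nlinarith [hr.1, hr.2]
  have hr0 := hr.1
  rw [(hderiv r hr).deriv]
  refine div_neg_of_neg_of_pos ?_ (by positivity)
  -- `𝒦(s') = 𝒦(s) 𝒦(r') / (K 𝒦(r))` for `s = φ_K(r)`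
  have hcompl : ellipticK √(1 - phiK K r ^ 2)
      = ellipticK (phiK K r) * ellipticK √(1 - r ^ 2) / (K * ellipticK r) := by
    rw [modulusMu, modulusMu] at hmu
    field_simp at hmu ⊢
    linarith
  simp only [hcompl] at hH
  rw [div_lt_div_iff₀ has har] at hH
  have h1 : phiK K r * ellipticK (phiK K r) ^ 2 * artanh r
      < K * r * ellipticK r ^ 2 * artanh (phiK K r) := by
    have e : phiK K r * (ellipticK (phiK K r) * (ellipticK (phiK K r) * ellipticK √(1 - r ^ 2)
        / (K * ellipticK r))) * artanh r
        = (phiK K r * ellipticK (phiK K r) ^ 2 * artanh r)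
          * (ellipticK √(1 - r ^ 2) / (K * ellipticK r)) := by
      field_simp
    have e' : r * (ellipticK r * ellipticK √(1 - r ^ 2)) * artanh (phiK K r)
        = (K * r * ellipticK r ^ 2 * artanh (phiK K r))
          * (ellipticK √(1 - r ^ 2) / (K * ellipticK r)) := by
      field_simp
    rw [e, e'] at hH
    exact lt_of_mul_lt_mul_right hH (by positivity)
  have h2 : phiK K r * ellipticK (phiK K r) ^ 2 / (K * (r * (1 - r ^ 2) * ellipticK r ^ 2))
        * artanh r - artanh (phiK K r) * (1 / (1 - r ^ 2))
      = (phiK K r * ellipticK (phiK K r) ^ 2 * artanh r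
          - K * r * ellipticK r ^ 2 * artanh (phiK K r))
        / (K * (r * (1 - r ^ 2) * ellipticK r ^ 2)) := by
    field_simp
  rw [h2]
  exact div_neg_of_neg_of_pos (sub_neg.2 h1) (by positivity)

/-- Write `s = φ_K(r) > r`. The sign of the derivative is that of the difference of
`r 𝒦(r)² / artanh r` between `s` and `r`. -/
theorem strictMonoOn_log_artanh_phiK_sub {K : ℝ} (hK : 1 < K) :
    StrictMonoOn (fun r => log (artanh (phiK K r)) - 1 / K * log (artanh r)) (Ioo 0 1) := by
  have hK0 : 0 < K := by linarith
  have hderiv : ∀ r ∈ Ioo (0 : ℝ) 1,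
      HasDerivAt (fun r => log (artanh (phiK K r)) - 1 / K * log (artanh r)) _ r :=
    fun r hr => ((hasDerivAt_artanh_phiK hK0 hr).log (artanh_pos (phiK_mem hK0 hr)).ne').fun_sub
      (((hasDerivAt_artanh ⟨by linarith [hr.1], hr.2⟩).log (artanh_pos hr).ne').const_mul (1 / K))
  refine strictMonoOn_of_deriv_pos (convex_Ioo 0 1) (fun x hx =>
    (hderiv x hx).continuousAt.continuousWithinAt) fun r hr => ?_
  rw [interior_Ioo] at hr
  have hs := phiK_mem hK0 hr
  have hG := strictMonoOn_mul_ellipticK_sq_div_artanh hr hs (lt_phiK hK hr)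
  have hKr := ellipticK_pos (abs_lt_one_of_mem hr)
  have har := artanh_pos hr
  have has := artanh_pos hs
  have hr1 : 0 < 1 - r ^ 2 := by nlinarith [hr.1, hr.2]
  have hr0 := hr.1
  rw [(hderiv r hr).deriv]
  have h2 : phiK K r * ellipticK (phiK K r) ^ 2 / (K * (r * (1 - r ^ 2) * ellipticK r ^ 2))
        / artanh (phiK K r) - 1 / K * (1 / (1 - r ^ 2) / artanh r)
      = (phiK K r * ellipticK (phiK K r) ^ 2 / artanh (phiK K r)
          - r * ellipticK r ^ 2 / artanh r) / (K * (r * (1 - r ^ 2) * ellipticK r ^ 2)) := by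
    field_simp
  rw [h2]
  exact div_pos (sub_pos.2 hG) (by positivity)

/-! ### The distortion ratio in the hyperbolic variable `t = 2 artanh r` -/

theorem tanh_half_mem {t : ℝ} (ht : 0 < t) : tanh (t / 2) ∈ Ioo (0 : ℝ) 1 := by
  refine ⟨?_, tanh_lt_one _⟩
  rw [tanh_eq_sinh_div_cosh]
  exact div_pos (sinh_pos_iff.2 (by linarith)) (cosh_pos _)

theorem tanh_half_lt {s t : ℝ} (hst : s < t) : tanh (s / 2) < tanh (t / 2) := by
  rw [← artanh_lt_artanh_iff ⟨neg_one_lt_tanh _, tanh_lt_one _⟩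
    ⟨neg_one_lt_tanh _, tanh_lt_one _⟩, artanh_tanh, artanh_tanh]
  linarith

/-- The numerator `2 artanh(φ_K(tanh(t/2)))` of `distortionRatio`. -/
noncomputable def distortionNumerator (K t : ℝ) : ℝ :=
  2 * artanh (phiK K (tanh (t / 2)))

theorem distortionNumerator_pos {K t : ℝ} (hK : 0 < K) (ht : 0 < t) :
    0 < distortionNumerator K t :=
  mul_pos two_pos (artanh_pos (phiK_mem hK (tanh_half_mem ht)))

theorem strictAntiOn_distortionNumerator_div {K : ℝ} (hK : 1 < K) :
    StrictAntiOn (fun t => distortionNumerator K t / t) (Ioi 0) := by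
  have key : ∀ t, distortionNumerator K t / t
      = artanh (phiK K (tanh (t / 2))) / artanh (tanh (t / 2)) := by
    intro t
    rw [artanh_tanh, distortionNumerator, div_div_eq_mul_div, mul_comm]
  intro s hs t ht hst
  simp only [key]
  exact strictAntiOn_artanh_phiK_div_artanh hK (tanh_half_mem hs) (tanh_half_mem ht)
    (tanh_half_lt hst)

theorem strictMonoOn_distortionNumerator_div_rpow {K : ℝ} (hK : 1 < K) :
    StrictMonoOn (fun t => distortionNumerator K t / t ^ (1 / K)) (Ioi 0) := by
  have hK0 : 0 < K := by linarith
  intro s hs t ht hst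
  have h := strictMonoOn_log_artanh_phiK_sub hK (tanh_half_mem hs) (tanh_half_mem ht)
    (tanh_half_lt hst)
  simp only [artanh_tanh] at h
  have key : ∀ t ∈ Ioi (0 : ℝ), log (distortionNumerator K t / t ^ (1 / K))
      = log (artanh (phiK K (tanh (t / 2)))) - 1 / K * log (t / 2)
        + (1 - 1 / K) * log 2 := by
    intro t ht
    have ht0 : 0 < t := ht
    have ha := artanh_pos (phiK_mem hK0 (tanh_half_mem ht0))
    rw [log_div (distortionNumerator_pos hK0 ht0).ne' (by positivity), distortionNumerator,
      log_mul two_ne_zero ha.ne', log_rpow ht0, log_div ht0.ne' two_ne_zero]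
    ring
  have hpos : ∀ t ∈ Ioi (0 : ℝ), 0 < distortionNumerator K t / t ^ (1 / K) := fun t ht =>
    div_pos (distortionNumerator_pos hK0 ht) (rpow_pos_of_pos ht _)
  refine (log_lt_log_iff (hpos s hs) (hpos t ht)).1 ?_
  rw [key s hs, key t ht]
  linarith

theorem distortionRatio_eq_div_rpow {K t : ℝ} (hK : 1 < K) (h0 : 0 < t) (h1 : t ≤ 1) :
    distortionRatio K t = distortionNumerator K t / t ^ (1 / K) := by
  have h : t ^ (1 : ℝ) ≤ t ^ (1 / K) :=
    rpow_le_rpow_of_exponent_ge h0 h1 ((div_le_one (by linarith)).2 hK.le)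
  rw [rpow_one] at h
  rw [distortionRatio, max_eq_right h, distortionNumerator]

theorem distortionRatio_eq_div {K t : ℝ} (hK : 1 < K) (h1 : 1 ≤ t) :
    distortionRatio K t = distortionNumerator K t / t := by
  have h : t ^ (1 / K) ≤ t ^ (1 : ℝ) :=
    rpow_le_rpow_of_exponent_le h1 ((div_le_one (by linarith)).2 hK.le)
  rw [rpow_one] at h
  rw [distortionRatio, max_eq_left h, distortionNumerator]

theorem lemma4 (K : ℝ) (hK : 1 < K) :
    StrictMonoOn (distortionRatio K) (Set.Ioo 0 1) ∧
    StrictAntiOn (distortionRatio K) (Set.Ioi 1) ∧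
    distortionRatio K 1 = cConst K ∧
    ∀ t : ℝ, 0 < t → distortionRatio K t ≤ cConst K := by
  have hmono : StrictMonoOn (distortionRatio K) (Ioc 0 1) := by
    intro s hs t ht hst
    rw [distortionRatio_eq_div_rpow hK hs.1 hs.2, distortionRatio_eq_div_rpow hK ht.1 ht.2]
    exact strictMonoOn_distortionNumerator_div_rpow hK hs.1 ht.1 hst
  have hanti : StrictAntiOn (distortionRatio K) (Ici 1) := by
    intro s hs t ht hst
    rw [mem_Ici] at hs ht
    rw [distortionRatio_eq_div hK hs, distortionRatio_eq_div hK ht]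
    exact strictAntiOn_distortionNumerator_div hK (one_pos.trans_le hs) (one_pos.trans_le ht) hst
  have hone : distortionRatio K 1 = cConst K := by
    rw [distortionRatio_eq_div hK le_rfl, div_one, distortionNumerator, cConst]
  refine ⟨hmono.mono Ioo_subset_Ioc_self, hanti.mono Ioi_subset_Ici_self, hone, fun t ht => ?_⟩
  rw [← hone]
  rcases le_total t 1 with h | h
  · exact hmono.monotoneOn ⟨ht, h⟩ ⟨one_pos, le_rfl⟩ h
  · exact hanti.antitoneOn (mem_Ici.2 le_rfl) h h
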